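/- Let $\{a,b\}^+$ be the free semigroup of nonempty finite words over $\{a,b\}$, let $\mu$ be its endomorphism given by $\mu(a)=ab$, $\mu(b)=ba$, and let $\mathbf{t}$ be the Prouhet–Thue–Morse sequence, that is, the infinite word whose prefix of length $2^n$ is $\mu^n(a)$ for every $n\ge 0$. A finite word is a segment of $\mathbf{t}$ if it is a nonempty block of consecutive letters of $\mathbf{t}$. A word $w\in\{a,b\}^+$ is unavoidable in $\mathbf{t}$ (a binary pattern of $\mathbf{t}$) if there is an endomorphism $\varphi$ of $\{a,b\}^+$ such that $\varphi(w)$ is a segment of $\mathbf{t}$. Theorem. A word $w\in\{a,b\}^+$ is unavoidable in $\mathbf{t}$ if and only if it is a segment of $\mathbf{t}$ or one of the two words $a^2ba^2$ and $b^2ab^2$. Moreover, neither of these two words is a segment of $\mathbf{t}$, so that, apart from these two exceptions, the binary patterns of $\mathbf{t}$ are exactly its finite segments. -/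

import Mathlib

namespace ThueMorse

/-- The two-letter alphabet `{a, b}`. -/
inductive Letter where
  | a : Letter
  | b : Letter
  deriving DecidableEq

open Letter

/-- The free semigroup `{a, b}⁺` of nonempty finite words over `{a, b}`. -/
abbrev Word := FreeSemigroup Letter

/-- The one-letter word `a`. -/
abbrev wa : Word := FreeSemigroup.of a

/-- The one-letter word `b`. -/
abbrev wb : Word := FreeSemigroup.of b

/-- The list of letters of a nonempty word, from left to right. -/
def letters {A : Type*} (u : FreeSemigroup A) : List A := u.head :: u.tail

theorem letters_length {A : Type*} (u : FreeSemigroup A) :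
    (letters u).length = u.length := rfl

theorem letters_mul {A : Type*} (u v : FreeSemigroup A) :
    letters (u * v) = letters u ++ letters v := rfl

/-- The endomorphism `μ` of `{a, b}⁺` with `μ(a) = ab` and `μ(b) = ba`. -/
def mu : Word →ₙ* Word :=
  FreeSemigroup.lift fun x => match x with
    | a => wa * wb
    | b => wb * wa

theorem length_mu (u : Word) : (mu u).length = 2 * u.length := by
  induction u using FreeSemigroup.recOnMul with
  | ih1 x => cases x <;> rfl
  | ih2 x y hx hy => rw [map_mul, FreeSemigroup.length_mul, FreeSemigroup.length_mul, hx, hy]; ring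

theorem length_iterate_mu (n : ℕ) (u : Word) : (mu^[n] u).length = 2 ^ n * u.length := by
  induction n with
  | zero => simp
  | succ n ih => rw [Function.iterate_succ_apply', length_mu, ih]; ring

theorem lt_length_iterate_mu (n : ℕ) : n < (letters (mu^[n] wa)).length := by
  rw [letters_length, length_iterate_mu]
  simpa using Nat.lt_two_pow_self

/-- The Prouhet–Thue–Morse sequence `t`, indexed from `0`: its letter at position `n` is that of
`μⁿ(a)`, whose length is `2ⁿ > n`. By `prefix_thueMorse` below, it is the infinite word
whose prefix of length `2ⁿ` is `μⁿ(a)` for every `n`. -/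
def thueMorse (n : ℕ) : Letter := (letters (mu^[n] wa))[n]'(lt_length_iterate_mu n)

theorem iterate_mu_succ_eq (n : ℕ) : mu^[n + 1] wa = mu^[n] wa * mu^[n] wb := by
  induction n with
  | zero => rfl
  | succ n ih =>
    rw [Function.iterate_succ_apply', ih, map_mul, ← ih]
    simp only [Function.iterate_succ_apply']

theorem iterate_mu_prefix {m n : ℕ} (h : m ≤ n) :
    letters (mu^[m] wa) <+: letters (mu^[n] wa) := by
  induction n, h using Nat.le_induction with
  | base => exact List.prefix_refl _
  | succ n _ ih =>
    refine ih.trans ?_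
    rw [iterate_mu_succ_eq, letters_mul]
    exact List.prefix_append _ _

/-- `μⁿ(a)` is the prefix of length `2ⁿ` of `t`. -/
theorem prefix_thueMorse (n : ℕ) :
    letters (mu^[n] wa) = (List.range (2 ^ n)).map thueMorse := by
  have hl : (letters (mu^[n] wa)).length = 2 ^ n := by
    rw [letters_length, length_iterate_mu]; simp
  refine List.ext_getElem (by simp [hl]) fun i h₁ h₂ => ?_
  rw [List.getElem_map, List.getElem_range, thueMorse]
  rcases le_total i n with h | h
  · exact ((iterate_mu_prefix h).getElem (lt_length_iterate_mu i)).symm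
  · exact (iterate_mu_prefix h).getElem h₁

/-- The finite word `u` is a segment of the infinite word `x`: it is a block of consecutive
letters of `x`, starting at some position `m`. -/
def IsSegment {A : Type*} (x : ℕ → A) (u : FreeSemigroup A) : Prop :=
  ∃ m : ℕ, letters u = (List.range u.length).map fun i => x (m + i)

/-- The word `w ∈ A⁺` is avoided by the infinite word `x` over `B`: there is no homomorphism
`φ : A⁺ → B⁺` such that `φ(w)` is a segment of `x`. -/
def IsAvoidedBy {A B : Type*} (w : FreeSemigroup A) (x : ℕ → B) : Prop :=
  ¬ ∃ φ : FreeSemigroup A →ₙ* FreeSemigroup B, IsSegment x (φ w)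

/-- The word `w` is unavoidable in `x`, or a pattern of `x`: it is not avoided by `x`. -/
def IsUnavoidableIn {A B : Type*} (w : FreeSemigroup A) (x : ℕ → B) : Prop :=
  ¬ IsAvoidedBy w x

end ThueMorse

namespace ThueMorse

open Letter

/-- The letter `b` is coded by `true`. -/
def Letter.toBool : Letter → Bool
  | a => false
  | b => true

theorem Letter.toBool_injective : Function.Injective Letter.toBool := by
  intro x y h
  cases x <;> cases y <;> simp_all [Letter.toBool]

/-- The Thue–Morse sequence over `Bool`. -/
def tm (n : ℕ) : Bool := (thueMorse n).toBool

/-- The Thue–Morse substitution on lists of booleans. -/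
def subst (u : List Bool) : List Bool := u.flatMap fun x => [x, !x]

theorem map_letters_mu (u : Word) :
    (letters (mu u)).map Letter.toBool = subst ((letters u).map Letter.toBool) := by
  induction u using FreeSemigroup.recOnMul with
  | ih1 x => cases x <;> rfl
  | ih2 x y hx hy =>
    rw [map_mul, letters_mul, letters_mul, List.map_append, hx, hy]
    simp [subst]

theorem map_letters_iterate_mu (n : ℕ) (u : Word) :
    (letters (mu^[n] u)).map Letter.toBool = subst^[n] ((letters u).map Letter.toBool) := by
  induction n with
  | zero => rfl
  | succ n ih => rw [Function.iterate_succ_apply', map_letters_mu, ih, Function.iterate_succ_apply']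

theorem map_tm_range (n : ℕ) : (List.range (2 ^ n)).map tm = subst^[n] [false] := by
  have h := map_letters_iterate_mu n wa
  rw [prefix_thueMorse, List.map_map] at h
  exact h

theorem subst_getElem? (u : List Bool) (n : ℕ) :
    (subst u)[2 * n]? = u[n]? ∧ (subst u)[2 * n + 1]? = (u[n]?).map not := by
  induction u generalizing n with
  | nil => simp [subst]
  | cons x u ih =>
    cases n with
    | zero => simp [subst]
    | succ n => simpa [subst, mul_add] using ih n

theorem subst_map_tm_range (n : ℕ) :
    (List.range (2 ^ (n + 1))).map tm = subst ((List.range (2 ^ n)).map tm) := by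
  rw [map_tm_range, map_tm_range, Function.iterate_succ_apply']

theorem tm_two_mul (n : ℕ) : tm (2 * n) = tm n := by
  have h := congrArg (fun l => l[2 * n]?) (subst_map_tm_range n)
  have hn : n < 2 ^ n := Nat.lt_two_pow_self
  have h2 : 2 * n < 2 ^ (n + 1) := by rw [pow_succ]; omega
  simpa [(subst_getElem? _ n).1, List.getElem?_range, hn, h2] using h

theorem tm_two_mul_add_one (n : ℕ) : tm (2 * n + 1) = !tm n := by
  have h := congrArg (fun l => l[2 * n + 1]?) (subst_map_tm_range n)
  have hn : n < 2 ^ n := Nat.lt_two_pow_self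
  have h2 : 2 * n + 1 < 2 ^ (n + 1) := by rw [pow_succ]; omega
  simpa [(subst_getElem? _ n).2, List.getElem?_range, hn, h2] using h

theorem tm_add_two_pow (k n : ℕ) (h : n < 2 ^ k) : tm (n + 2 ^ k) = !tm n := by
  induction k generalizing n with
  | zero =>
    obtain rfl : n = 0 := by simpa using h
    simpa using tm_two_mul_add_one 0
  | succ k ih =>
    rw [pow_succ] at h ⊢
    obtain ⟨m, rfl | rfl⟩ := Nat.even_or_odd' n
    · rw [show 2 * m + 2 ^ k * 2 = 2 * (m + 2 ^ k) by ring, tm_two_mul, tm_two_mul, ih m (by omega)]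
    · rw [show 2 * m + 1 + 2 ^ k * 2 = 2 * (m + 2 ^ k) + 1 by ring, tm_two_mul_add_one,
        tm_two_mul_add_one, ih m (by omega)]

/-! ### Squares and overlaps -/

theorem not_three_eq (n : ℕ) (h₁ : tm n = tm (n + 1)) (h₂ : tm (n + 1) = tm (n + 2)) : False := by
  obtain ⟨m, rfl | rfl⟩ := Nat.even_or_odd' n
  · rw [tm_two_mul, tm_two_mul_add_one] at h₁
    simp at h₁
  · rw [show 2 * m + 1 + 1 = 2 * (m + 1) by ring, show 2 * m + 1 + 2 = 2 * (m + 1) + 1 by ring,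
      tm_two_mul, tm_two_mul_add_one] at h₂
    simp at h₂

theorem tm_ne_succ_of_even {n : ℕ} (h : n % 2 = 0) : tm n ≠ tm (n + 1) := by
  obtain ⟨m, rfl⟩ : ∃ m, n = 2 * m := ⟨n / 2, by omega⟩
  rw [tm_two_mul, tm_two_mul_add_one]
  simp

/-- Five consecutive letters do not alternate. -/
theorem not_alternating (n : ℕ) (h : ∀ j < 4, tm (n + j) ≠ tm (n + j + 1)) : False := by
  have h0 := h 0 (by simp)
  have h1 := h 1 (by simp)
  have h2 := h 2 (by simp)
  have h3 := h 3 (by simp)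
  obtain ⟨m, rfl | rfl⟩ := Nat.even_or_odd' n
  · rw [show 2 * m + 1 + 1 = 2 * (m + 1) by ring, tm_two_mul, tm_two_mul_add_one] at h1
    rw [show 2 * m + 3 + 1 = 2 * (m + 2) by ring, show 2 * m + 3 = 2 * (m + 1) + 1 by ring,
      tm_two_mul, tm_two_mul_add_one] at h3
    apply not_three_eq m
    · revert h1; cases tm m <;> cases tm (m + 1) <;> simp
    · revert h3; cases tm (m + 1) <;> cases tm (m + 2) <;> simp
  · rw [show 2 * m + 1 + 0 + 1 = 2 * (m + 1) by ring, show 2 * m + 1 + 0 = 2 * m + 1 by ring,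
      tm_two_mul, tm_two_mul_add_one] at h0
    rw [show 2 * m + 1 + 2 + 1 = 2 * (m + 2) by ring,
      show 2 * m + 1 + 2 = 2 * (m + 1) + 1 by ring, tm_two_mul, tm_two_mul_add_one] at h2
    apply not_three_eq m
    · revert h0; cases tm m <;> cases tm (m + 1) <;> simp
    · revert h2; cases tm (m + 1) <;> cases tm (m + 2) <;> simp

theorem square_of_odd {i p : ℕ} (hp : p % 2 = 1) (h : ∀ j < p, tm (i + j) = tm (i + j + p)) :
    i % 2 = 1 ∧ (p = 1 ∨ p = 3) := by
  have alt : ∀ j, j + 1 < p → tm (i + j) ≠ tm (i + j + 1) := by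
    intro j hj
    rcases Nat.mod_two_eq_zero_or_one (i + j) with he | ho
    · exact tm_ne_succ_of_even he
    · have h0 := h j (by omega)
      have h1 := h (j + 1) hj
      rw [← add_assoc, show i + j + 1 + p = i + j + p + 1 by ring] at h1
      rw [h0, h1]
      exact tm_ne_succ_of_even (by omega)
  have hp5 : p < 5 := by
    by_contra hp5
    exact not_alternating i fun j hj => alt j (by omega)
  refine ⟨?_, by omega⟩
  by_contra hi
  obtain rfl | rfl : p = 1 ∨ p = 3 := by omega
  · exact tm_ne_succ_of_even (by omega) (h 0 (by simp))
  · have h0 := h 0 (by simp)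
    have a0 := alt 0 (by simp)
    have a1 := alt 1 (by simp)
    have a2 : tm (i + 2) ≠ tm (i + 2 + 1) := tm_ne_succ_of_even (by omega)
    simp only [add_zero, add_assoc, Nat.reduceAdd] at h0 a0 a1 a2
    revert h0 a0 a1 a2
    cases tm i <;> cases tm (i + 1) <;> cases tm (i + 2) <;> cases tm (i + 3) <;> simp

theorem tm_overlapFree {i p : ℕ} (hp : 0 < p) (h : ∀ j ≤ p, tm (i + j) = tm (i + j + p)) :
    False := by
  induction p using Nat.strong_induction_on generalizing i with
  | _ p ih =>
    obtain ⟨q, rfl | rfl⟩ := Nat.even_or_odd' p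
    · obtain ⟨m, rfl | rfl⟩ := Nat.even_or_odd' i
      · refine ih q (by omega) (by omega) (i := m) fun j hj => ?_
        have := h (2 * j) (by omega)
        rwa [show 2 * m + 2 * j + 2 * q = 2 * (m + j + q) by ring,
          show 2 * m + 2 * j = 2 * (m + j) by ring, tm_two_mul, tm_two_mul] at this
      · refine ih q (by omega) (by omega) (i := m) fun j hj => ?_
        have := h (2 * j) (by omega)
        rw [show 2 * m + 1 + 2 * j + 2 * q = 2 * (m + j + q) + 1 by ring,
          show 2 * m + 1 + 2 * j = 2 * (m + j) + 1 by ring, tm_two_mul_add_one,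
          tm_two_mul_add_one] at this
        simpa using this
    · have h1 := square_of_odd (i := i) (p := 2 * q + 1) (by omega) fun j hj => h j hj.le
      have h2 := square_of_odd (i := i + 1) (p := 2 * q + 1) (by omega) fun j hj => by
        have := h (j + 1) hj
        rwa [show i + (j + 1) = i + 1 + j by ring] at this
      omega

theorem square_of_even {i p : ℕ} (hp0 : 0 < p) (hp : p % 2 = 0)
    (h : ∀ j < p, tm (i + j) = tm (i + j + p)) : i % 2 = 0 := by
  by_contra hi
  obtain ⟨m, rfl⟩ : ∃ m, i = 2 * m + 1 := ⟨i / 2, by omega⟩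
  obtain ⟨q, rfl⟩ : ∃ q, p = 2 * q := ⟨p / 2, by omega⟩
  refine tm_overlapFree (i := 2 * m) hp0 fun j hj => ?_
  rcases j with _ | j
  · have := h 0 hp0
    rw [show 2 * m + 1 + 0 + 2 * q = 2 * (m + q) + 1 by ring, add_zero, tm_two_mul_add_one,
      tm_two_mul_add_one] at this
    rw [show 2 * m + 0 + 2 * q = 2 * (m + q) by ring, add_zero, tm_two_mul, tm_two_mul]
    simpa using this
  · have := h j (by omega)
    rwa [show 2 * m + 1 + j = 2 * m + (j + 1) by ring] at this

/-! ### Occurrences -/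

/-- The word `u` occurs in the Thue–Morse sequence at position `m`. -/
def OccAt : ℕ → List Bool → Prop
  | _, [] => True
  | m, x :: u => tm m = x ∧ OccAt (m + 1) u

/-- The word `u` occurs in the Thue–Morse sequence. -/
def Occ (u : List Bool) : Prop := ∃ m, OccAt m u

theorem occAt_append {m : ℕ} {u v : List Bool} :
    OccAt m (u ++ v) ↔ OccAt m u ∧ OccAt (m + u.length) v := by
  induction u generalizing m with
  | nil => simp [OccAt]
  | cons x u ih => simp [OccAt, ih, and_assoc, add_assoc, add_comm 1]

theorem occAt_iff {m : ℕ} {u : List Bool} :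
    OccAt m u ↔ ∀ j, (h : j < u.length) → tm (m + j) = u[j] := by
  induction u generalizing m with
  | nil => simp [OccAt]
  | cons x u ih =>
    rw [OccAt, ih]
    constructor
    · rintro ⟨h0, h⟩ (_ | j) hj
      · exact h0
      · have := h j (by simpa using hj)
        rwa [add_assoc, add_comm 1] at this
    · intro h
      refine ⟨h 0 (by simp), fun j hj => ?_⟩
      have := h (j + 1) (by simpa using hj)
      rwa [add_assoc, add_comm 1]

theorem Occ.of_infix {u v : List Bool} (h : Occ v) (huv : u <:+: v) : Occ u := by
  obtain ⟨s, t, rfl⟩ := huv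
  obtain ⟨m, hm⟩ := h
  rw [List.append_assoc, occAt_append, occAt_append] at hm
  exact ⟨_, hm.2.1⟩

theorem occAt_map_range (n m : ℕ) : OccAt m ((List.range n).map fun i => tm (m + i)) := by
  rw [occAt_iff]
  simp

theorem occAt_iff_eq {m : ℕ} {u : List Bool} :
    OccAt m u ↔ u = (List.range u.length).map fun i => tm (m + i) := by
  constructor
  · intro h
    rw [occAt_iff] at h
    exact List.ext_getElem (by simp) fun j h1 h2 => by simp [h j h1]
  · intro h
    rw [h]
    exact occAt_map_range _ _

theorem Occ.map_not {u : List Bool} (h : Occ u) : Occ (u.map not) := by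
  obtain ⟨m, hm⟩ := h
  refine ⟨m + 2 ^ (m + u.length), ?_⟩
  rw [occAt_iff] at hm ⊢
  intro j hj
  rw [List.length_map] at hj
  have : m + u.length < 2 ^ (m + u.length) := Nat.lt_two_pow_self
  rw [List.getElem_map, ← hm j hj, add_right_comm, tm_add_two_pow _ _ (by omega)]

/-- A prefix of length 64 of the Thue–Morse sequence. -/
def initialSegment : List Bool := subst^[6] [false]

theorem occ_of_infix_initialSegment {u : List Bool} (h : u <:+: initialSegment) : Occ u := by
  refine Occ.of_infix ⟨0, ?_⟩ h
  rw [initialSegment, ← map_tm_range]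
  have h := occAt_map_range (2 ^ 6) 0
  simp only [zero_add] at h
  exact h

/-- Squares of odd root length have root length 1 or 3 and start at an odd position. -/
theorem OccAt.square_odd {m : ℕ} {u : List Bool} (h : OccAt m (u ++ u)) (hu : u.length % 2 = 1) :
    m % 2 = 1 ∧ (u.length = 1 ∨ u.length = 3) := by
  rw [occAt_append, occAt_iff, occAt_iff] at h
  refine square_of_odd hu fun j hj => ?_
  rw [h.1 j hj, add_right_comm, h.2 j hj]

theorem OccAt.square_even {m : ℕ} {u : List Bool} (h : OccAt m (u ++ u)) (hu : u.length % 2 = 0)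
    (hu0 : u ≠ []) : m % 2 = 0 := by
  rw [occAt_append, occAt_iff, occAt_iff] at h
  refine square_of_even (List.length_pos_iff.2 hu0) hu fun j hj => ?_
  rw [h.1 j hj, add_right_comm, h.2 j hj]

theorem not_occAt_overlap {m : ℕ} {u v : List Bool} (hu : u ≠ []) :
    ¬ OccAt m (u ++ v ++ (u ++ v) ++ u) := by
  intro h
  obtain ⟨x, s, rfl⟩ := List.exists_cons_of_ne_nil hu
  rw [occAt_append, occAt_append] at h
  obtain ⟨⟨h1, h2⟩, h3⟩ := h
  generalize hw : x :: s ++ v = w at *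
  have hl : 0 < w.length := by rw [← hw]; simp
  have h4 : tm (m + w.length) = tm (m + w.length + w.length) := by
    have a1 : tm (m + w.length) = x := by rw [← hw] at h2 ⊢; exact h2.1
    have a2 := h3.1
    rw [List.length_append, ← add_assoc] at a2
    rw [a1, a2]
  rw [occAt_iff] at h1 h2
  refine tm_overlapFree hl (i := m) fun j hj => ?_
  rcases hj.lt_or_eq with hj | rfl
  · rw [h1 j hj, add_right_comm, h2 j hj]
  · exact h4

/-! ### Halving -/

/-- The letters of a list at even positions. -/
def half : List Bool → List Bool
  | [] => []
  | [x] => [x]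
  | x :: _ :: u => x :: half u

theorem half_append (u v : List Bool) (hu : u.length % 2 = 0) :
    half (u ++ v) = half u ++ half v := by
  induction u using half.induct with
  | case1 => rfl
  | case2 x => simp at hu
  | case3 x y u ih =>
    have : u.length % 2 = 0 := by simp at hu; omega
    simp [half, ih this]

theorem two_mul_length_half (u : List Bool) (hu : u.length % 2 = 0) :
    2 * (half u).length = u.length := by
  induction u using half.induct with
  | case1 => rfl
  | case2 x => simp at hu
  | case3 x y u ih =>
    have : u.length % 2 = 0 := by simp at hu; omega
    have := ih this
    simp only [half, List.length_cons]
    omega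

theorem half_ne_nil {u : List Bool} (hu : u ≠ []) : half u ≠ [] := by
  induction u using half.induct <;> simp_all [half]

theorem half_flatMap {f : Bool → List Bool} (hf : ∀ x, (f x).length % 2 = 0) (w : List Bool) :
    half (w.flatMap f) = w.flatMap fun x => half (f x) := by
  induction w with
  | nil => rfl
  | cons x w ih => rw [List.flatMap_cons, half_append _ _ (hf x), ih, List.flatMap_cons]

theorem OccAt.half {m : ℕ} {u : List Bool} (h : OccAt (2 * m) u) : OccAt m (half u) := by
  induction u using half.induct generalizing m with
  | case1 => exact h
  | case2 x => exact ⟨(tm_two_mul m).symm.trans h.1, trivial⟩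
  | case3 x y u ih =>
    refine ⟨(tm_two_mul m).symm.trans h.1, ih ?_⟩
    have := h.2.2
    rwa [show 2 * m + 1 + 1 = 2 * (m + 1) by ring] at this

/-- The blocks at positions `2 * k`, `2 * k + 1` of the list consist of distinct letters. -/
def distinctBlocks : List Bool → Bool
  | x :: y :: u => (x != y) && distinctBlocks u
  | _ => true

theorem OccAt.distinctBlocks {m : ℕ} {u : List Bool} (h : OccAt (2 * m) u) :
    distinctBlocks u = true := by
  induction u using half.induct generalizing m with
  | case1 => rfl
  | case2 x => rfl
  | case3 x y u ih =>
    obtain ⟨h0, h1, h2⟩ := h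
    rw [show 2 * m + 1 + 1 = 2 * (m + 1) by ring] at h2
    rw [ThueMorse.distinctBlocks, ih h2, ← h0, ← h1, tm_two_mul, tm_two_mul_add_one]
    simp

/-- The list can be desubstituted `n` times, as a factor of a fixed point of `subst` can be. -/
def desubstitutable : ℕ → List Bool → Bool
  | 0, _ => true
  | _ + 1, [] => true
  | n + 1, x :: u =>
    (distinctBlocks (x :: u) && desubstitutable n (half (x :: u))) ||
      (distinctBlocks ((!x) :: x :: u) && desubstitutable n (half ((!x) :: x :: u)))

theorem Occ.desubstitutable {u : List Bool} (h : Occ u) (n : ℕ) : desubstitutable n u = true := by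
  induction n generalizing u with
  | zero => simp [ThueMorse.desubstitutable]
  | succ n ih =>
    cases u with
    | nil => rfl
    | cons x u =>
      rw [ThueMorse.desubstitutable]
      obtain ⟨k, hk⟩ := h
      obtain ⟨m, rfl | rfl⟩ := Nat.even_or_odd' k
      · rw [hk.distinctBlocks, ih ⟨m, hk.half⟩]
        simp
      · have hk' : OccAt (2 * m) ((!x) :: x :: u) := by
          refine ⟨?_, hk⟩
          rw [← hk.1, tm_two_mul, tm_two_mul_add_one, Bool.not_not]
        rw [hk'.distinctBlocks, ih ⟨m, hk'.half⟩]
        simp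

theorem length_flatMap_even {f : Bool → List Bool} (hf : ∀ x, (f x).length % 2 = 0)
    (w : List Bool) : (w.flatMap f).length % 2 = 0 := by
  induction w with
  | nil => rfl
  | cons x w ih =>
    have := hf x
    rw [List.flatMap_cons, List.length_append]
    omega

/-- If all letters have images of even length and `w` contains a square, then an occurrence of
the image of `w` can be halved. -/
theorem occAt_half_flatMap {f : Bool → List Bool} (hf : ∀ x, (f x).length % 2 = 0)
    (hf0 : ∀ x, f x ≠ []) {m : ℕ} {w : List Bool} (h : OccAt m (w.flatMap f))
    (u : List Bool) (hu0 : u ≠ []) (hu : u ++ u <:+: w) :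
    Occ (w.flatMap fun x => half (f x)) := by
  have hm : m % 2 = 0 := by
    obtain ⟨s, t, rfl⟩ := hu
    simp only [List.flatMap_append] at h
    rw [List.append_assoc, occAt_append, occAt_append] at h
    have hs := length_flatMap_even hf s
    have := h.2.1.square_even (length_flatMap_even hf u) (by
      obtain ⟨x, u, rfl⟩ := List.exists_cons_of_ne_nil hu0
      simp [hf0])
    omega
  obtain ⟨q, rfl⟩ : ∃ q, m = 2 * q := ⟨m / 2, by omega⟩
  exact ⟨q, half_flatMap hf w ▸ h.half⟩

/-! ### Patterns -/

/-- The boolean word `w` is a pattern of the Thue–Morse sequence. -/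
def Pattern (w : List Bool) : Prop :=
  ∃ f : Bool → List Bool, (∀ x, f x ≠ []) ∧ Occ (w.flatMap f)

theorem Pattern.of_infix {u w : List Bool} (h : Pattern w) (hu : u <:+: w) : Pattern u := by
  obtain ⟨f, hf, hw⟩ := h
  refine ⟨f, hf, hw.of_infix ?_⟩
  obtain ⟨s, t, rfl⟩ := hu
  exact ⟨s.flatMap f, t.flatMap f, by simp only [List.flatMap_append]⟩

theorem not_pattern_overlap (x : Bool) (s : List Bool) :
    ¬ Pattern (x :: s ++ (x :: s) ++ [x]) := by
  rintro ⟨f, hf, m, hm⟩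
  refine not_occAt_overlap (m := m) (v := s.flatMap f) (hf x) ?_
  simpa using hm

theorem not_pattern_xxyxxy (x : Bool) : ¬ Pattern [x, x, !x, x, x, !x] := by
  rintro ⟨f, hf, hocc⟩
  induction hn : (f x).length + (f !x).length using Nat.strong_induction_on generalizing f with
  | _ n ih =>
    obtain ⟨m, hm⟩ := hocc
    have hx := List.length_pos_iff.2 (hf x)
    have hy := List.length_pos_iff.2 (hf !x)
    have hsq : OccAt m ((f x ++ f x ++ f !x) ++ (f x ++ f x ++ f !x)) := by simpa using hm
    have hxx : OccAt m (f x ++ f x) := by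
      rw [List.append_assoc (f x ++ f x), occAt_append] at hsq
      exact hsq.1
    rcases Nat.mod_two_eq_zero_or_one (f !x).length with h1 | h1
    · have he := hsq.square_even (by simp only [List.length_append]; omega) (by simp [hf])
      rcases Nat.mod_two_eq_zero_or_one (f x).length with h0 | h0
      · have hall : ∀ z, (f z).length % 2 = 0 := by
          intro z; cases x <;> cases z <;> assumption
        refine ih _ ?_ (fun z => half (f z)) (fun z => half_ne_nil (hf z))
          (occAt_half_flatMap hall hf hm [x] (by simp) ⟨[], _, rfl⟩) rfl
        have := two_mul_length_half _ h0
        have := two_mul_length_half _ h1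
        omega
      · have := (hxx.square_odd h0).1
        omega
    · have ho := (hsq.square_odd (by simp only [List.length_append]; omega)).2
      simp only [List.length_append] at ho
      obtain ⟨c, hc⟩ := List.length_eq_one_iff.1 (show (f x).length = 1 by omega)
      obtain ⟨d, hd⟩ := List.length_eq_one_iff.1 (show (f !x).length = 1 by omega)
      have := Occ.desubstitutable ⟨m, hsq⟩ 3
      rw [hc, hd] at this
      revert this
      cases c <;> cases d <;> decide +kernel

theorem not_pattern_yxxyxx (x : Bool) : ¬ Pattern [!x, x, x, !x, x, x] := by
  rintro ⟨f, hf, hocc⟩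
  induction hn : (f x).length + (f !x).length using Nat.strong_induction_on generalizing f with
  | _ n ih =>
    obtain ⟨m, hm⟩ := hocc
    have hx := List.length_pos_iff.2 (hf x)
    have hy := List.length_pos_iff.2 (hf !x)
    have hsq : OccAt m ((f (!x) ++ (f x ++ f x)) ++ (f (!x) ++ (f x ++ f x))) := by
      simpa using hm
    have hxx : OccAt (m + (f !x).length) (f x ++ f x) := by
      rw [occAt_append, occAt_append] at hsq
      exact hsq.1.2
    rcases Nat.mod_two_eq_zero_or_one (f !x).length with h1 | h1
    · have he := hsq.square_even (by simp only [List.length_append]; omega) (by simp [hf])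
      rcases Nat.mod_two_eq_zero_or_one (f x).length with h0 | h0
      · have hall : ∀ z, (f z).length % 2 = 0 := by
          intro z; cases x <;> cases z <;> assumption
        refine ih _ ?_ (fun z => half (f z)) (fun z => half_ne_nil (hf z))
          (occAt_half_flatMap hall hf hm [x] (by simp) ⟨[!x], _, rfl⟩) rfl
        have := two_mul_length_half _ h0
        have := two_mul_length_half _ h1
        omega
      · have := (hxx.square_odd h0).1
        omega
    · have ho := (hsq.square_odd (by simp only [List.length_append]; omega)).2
      simp only [List.length_append] at ho
      obtain ⟨c, hc⟩ := List.length_eq_one_iff.1 (show (f x).length = 1 by omega)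
      obtain ⟨d, hd⟩ := List.length_eq_one_iff.1 (show (f !x).length = 1 by omega)
      have := Occ.desubstitutable ⟨m, hsq⟩ 3
      rw [hc, hd] at this
      revert this
      cases c <;> cases d <;> decide +kernel

/-! ### Admissible words -/

/-- All boolean words of length `n`. -/
def boolWords : ℕ → List (List Bool)
  | 0 => [[]]
  | n + 1 => (boolWords n).flatMap fun w => [false :: w, true :: w]

theorem mem_boolWords (w : List Bool) : w ∈ boolWords w.length := by
  induction w with
  | nil => simp [boolWords]
  | cons x w ih =>
    simp only [List.length_cons, boolWords, List.mem_flatMap]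
    exact ⟨w, ih, by cases x <;> simp⟩

/-- Overlaps of period at most 4. -/
def shortOverlaps : List (List Bool) :=
  ([0, 1, 2, 3].flatMap boolWords).flatMap fun s =>
    [false, true].map fun x => x :: s ++ (x :: s) ++ [x]

/-- A finite list of words that are not patterns. -/
def forbidden : List (List Bool) :=
  shortOverlaps ++ [false, true].flatMap fun x => [[x, x, !x, x, x, !x], [!x, x, x, !x, x, x]]

theorem not_pattern_of_mem_forbidden {w : List Bool} (hw : w ∈ forbidden) : ¬ Pattern w := by
  simp only [forbidden, shortOverlaps, List.mem_append, List.mem_flatMap, List.mem_map] at hw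
  rcases hw with ⟨s, -, x, -, rfl⟩ | ⟨x, -, hw⟩
  · exact not_pattern_overlap x s
  · simp only [List.mem_cons, List.not_mem_nil, or_false] at hw
    rcases hw with rfl | rfl
    · exact not_pattern_xxyxxy x
    · exact not_pattern_yxxyxx x

/-- The words of length `n` without forbidden factors. -/
def admissible : ℕ → List (List Bool)
  | 0 => [[]]
  | n + 1 => ((admissible n).flatMap fun w => [false :: w, true :: w]).filter fun w =>
      !forbidden.any fun u => u.isPrefixOf w

theorem Pattern.mem_admissible {w : List Bool} (h : Pattern w) : w ∈ admissible w.length := by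
  induction w with
  | nil => simp [admissible]
  | cons x w ih =>
    rw [List.length_cons, admissible, List.mem_filter, List.mem_flatMap]
    refine ⟨⟨w, ih (h.of_infix (List.suffix_cons x w).isInfix), by cases x <;> simp⟩, ?_⟩
    rw [Bool.not_eq_true', List.any_eq_false]
    intro u hu hp
    exact not_pattern_of_mem_forbidden hu
      (h.of_infix (List.isPrefixOf_iff_prefix.1 hp).isInfix)

/-- The two exceptional patterns. -/
def exceptions : List (List Bool) :=
  [[false, false, true, false, false], [true, true, false, true, true]]

theorem admissible_short : ∀ n ∈ List.range 8, ∀ w ∈ admissible n,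
    w <:+: initialSegment ∨ w ∈ exceptions := by
  decide +kernel

/-- The factors of a word that bound the images of the letters when not all have even length. -/
def Bounding (w : List Bool) : Prop :=
  [false, false] <:+: w ∧ [true, true] <:+: w ∧
    (∃ x ∈ [false, true], [x, x, !x, !x] <:+: w ∨ [x, !x, x, !x] <:+: w)

instance (w : List Bool) : Decidable (Bounding w) := inferInstanceAs (Decidable (_ ∧ _ ∧ _))

theorem admissible_eight : ∀ w ∈ admissible 8, w <:+: initialSegment ∨ Bounding w := by
  decide +kernel

theorem admissible_nine : ∀ w ∈ admissible 9, Bounding w := by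
  decide +kernel

/-- The candidates for the images of the letters when not all have even length. -/
def smallImages : List (List Bool × List Bool) :=
  (([1, 2, 3].flatMap boolWords) ×ˢ ([1, 2, 3].flatMap boolWords)).filter fun p =>
    desubstitutable 3 (p.1 ++ p.1) && desubstitutable 3 (p.2 ++ p.2) &&
    (p.1.length % 2 == 1 || p.2.length % 2 == 1) &&
    p != ([false], [true]) && p != ([true], [false])

theorem not_desubstitutable_of_smallImages : ∀ p ∈ smallImages, ∀ w ∈ admissible 8,
    desubstitutable 5 (w.flatMap fun x => if x then p.2 else p.1) = false := by
  decide +kernel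

theorem Occ.flatMap_of_infix {f : Bool → List Bool} {u w : List Bool} (h : Occ (w.flatMap f))
    (hu : u <:+: w) : Occ (u.flatMap f) := by
  obtain ⟨s, t, rfl⟩ := hu
  exact h.of_infix ⟨s.flatMap f, t.flatMap f, by simp only [List.flatMap_append]⟩

theorem Bounding.of_infix {u w : List Bool} (h : Bounding u) (hu : u <:+: w) : Bounding w := by
  obtain ⟨h0, h1, x, hx, h2⟩ := h
  exact ⟨h0.trans hu, h1.trans hu, x, hx, h2.imp (·.trans hu) (·.trans hu)⟩

theorem length_le_three_of_bounding {f : Bool → List Bool} (hf : ∀ x, f x ≠ []) {w : List Bool}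
    (hw : Bounding w) (h : Occ (w.flatMap f)) (hodd : ¬ ∀ x, (f x).length % 2 = 0) (y : Bool) :
    (f y).length ≤ 3 := by
  obtain ⟨h0, h1, x, -, hx⟩ := hw
  have hsq : ∀ z, (f z).length % 2 = 1 → (f z).length ≤ 3 := by
    intro z hz
    have hzz : Occ (f z ++ f z) := by
      cases z
      · simpa using h.flatMap_of_infix h0
      · simpa using h.flatMap_of_infix h1
    obtain ⟨m, hm⟩ := hzz
    have := (hm.square_odd hz).2
    omega
  have hpos : ∀ z, 0 < (f z).length := fun z => List.length_pos_iff.2 (hf z)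
  have key : (f x).length ≤ 3 ∧ (f !x).length ≤ 3 := by
    have hne : (f x).length % 2 = 1 ∨ (f !x).length % 2 = 1 := by
      by_contra hcon
      refine hodd fun z => ?_
      cases x <;> cases z <;> simp at hcon ⊢ <;> omega
    by_cases hpar : (f x).length % 2 = (f !x).length % 2
    · exact ⟨hsq _ (by omega), hsq _ (by omega)⟩
    · rcases hx with hx | hx
      · obtain ⟨m, hm⟩ := h.flatMap_of_infix hx
        have hm' : OccAt m (f x ++ f x ++ (f (!x) ++ f (!x))) := by simpa using hm
        rw [occAt_append, List.length_append] at hm'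
        rcases Nat.mod_two_eq_zero_or_one (f x).length with h2 | h2
        · have a1 := hm'.1.square_even h2 (hf x)
          have a2 := (hm'.2.square_odd (by omega)).1
          omega
        · have a1 := (hm'.1.square_odd h2).1
          have a2 := hm'.2.square_even (by omega) (hf !x)
          omega
      · obtain ⟨m, hm⟩ := h.flatMap_of_infix hx
        have hm' : OccAt m ((f x ++ f !x) ++ (f x ++ f !x)) := by simpa using hm
        have := (hm'.square_odd (by rw [List.length_append]; omega)).2
        rw [List.length_append] at this
        omega
  cases x <;> cases y <;> simp_all

theorem mem_boolWords_of_length_le_three {u : List Bool} (h0 : u ≠ []) (h : u.length ≤ 3) :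
    u ∈ [1, 2, 3].flatMap boolWords := by
  have := List.length_pos_iff.2 h0
  rw [List.mem_flatMap]
  exact ⟨u.length, by simp; omega, mem_boolWords u⟩

/-- If not all letters have images of even length, then the images are single letters. -/
theorem images_of_bounding {f : Bool → List Bool} (hf : ∀ x, f x ≠ []) {w : List Bool}
    (hw : Bounding w) (hl : 8 ≤ w.length) (h : Occ (w.flatMap f))
    (hodd : ¬ ∀ x, (f x).length % 2 = 0) :
    (∀ x, f x = [x]) ∨ ∀ x, f x = [!x] := by
  by_contra hcon
  have hle := length_le_three_of_bounding hf hw h hodd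
  have hsq : ∀ z, desubstitutable 3 (f z ++ f z) = true := by
    intro z
    refine Occ.desubstitutable ?_ 3
    cases z
    · simpa using h.flatMap_of_infix hw.1
    · simpa using h.flatMap_of_infix hw.2.1
  have hmem : (f false, f true) ∈ smallImages := by
    rw [smallImages, List.mem_filter, SProd.sprod, List.instSProd, List.pair_mem_product]
    refine ⟨⟨mem_boolWords_of_length_le_three (hf _) (hle _),
      mem_boolWords_of_length_le_three (hf _) (hle _)⟩, ?_⟩
    simp only [Bool.forall_bool, not_and, not_or] at hcon hodd
    simp only [hsq, Bool.true_and, Bool.and_eq_true, Bool.or_eq_true, beq_iff_eq,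
      bne_iff_ne, ne_eq, Prod.mk.injEq, not_and]
    refine ⟨⟨?_, hcon.1⟩, hcon.2⟩
    omega
  have hfun : (fun x => if x then f true else f false) = f := by
    funext x; cases x <;> rfl
  have hp : Occ ((w.take 8).flatMap f) := h.flatMap_of_infix (List.take_prefix 8 w).isInfix
  have hadm : w.take 8 ∈ admissible 8 := by
    have : Pattern (w.take 8) := ⟨f, hf, hp⟩
    simpa [hl] using this.mem_admissible
  have hfalse := not_desubstitutable_of_smallImages _ hmem _ hadm
  rw [hfun, hp.desubstitutable] at hfalse
  simp at hfalse

theorem Occ.of_images {w : List Bool} (hw : Bounding w) (hl : 8 ≤ w.length)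
    (f : Bool → List Bool) (hf : ∀ x, f x ≠ []) (h : Occ (w.flatMap f)) : Occ w := by
  induction hn : (f false).length + (f true).length using Nat.strong_induction_on
    generalizing f with
  | _ n ih =>
    by_cases heven : ∀ x, (f x).length % 2 = 0
    · obtain ⟨m, hm⟩ := h
      refine ih _ ?_ (fun x => half (f x)) (fun x => half_ne_nil (hf x))
        (occAt_half_flatMap heven hf hm [false] (by simp) hw.1) rfl
      have := two_mul_length_half _ (heven false)
      have := two_mul_length_half _ (heven true)
      have := List.length_pos_iff.2 (hf false)
      omega
    · rcases images_of_bounding hf hw hl h heven with h1 | h1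
      · obtain rfl : f = fun x => [x] := funext h1
        simpa using h
      · obtain rfl : f = fun x => [!x] := funext h1
        have := h.map_not
        rw [List.map_flatMap] at this
        simpa using this

theorem Pattern.occ_or_mem_exceptions {w : List Bool} (h : Pattern w) :
    Occ w ∨ w ∈ exceptions := by
  rcases lt_or_ge w.length 8 with hl | hl
  · exact (admissible_short _ (List.mem_range.2 hl) w h.mem_admissible).imp_left
      occ_of_infix_initialSegment
  · have hb : Occ w ∨ Bounding w := by
      rcases hl.eq_or_lt with hl | hl
      · exact (admissible_eight w (hl ▸ h.mem_admissible)).imp_left occ_of_infix_initialSegment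
      · right
        have hp := (List.take_prefix 9 w).isInfix
        refine Bounding.of_infix (admissible_nine (w.take 9) ?_) hp
        have : min 9 w.length = 9 := by omega
        simpa [this] using (h.of_infix hp).mem_admissible
    rcases hb with hb | hb
    · exact Or.inl hb
    · obtain ⟨f, hf, hocc⟩ := h
      exact Or.inl (hocc.of_images hb hl f hf)

/-! ### Words over `{a, b}` -/

/-- The boolean code of a word. -/
def code (u : Word) : List Bool := (letters u).map Letter.toBool

theorem letters_injective {A : Type*} : Function.Injective (letters (A := A)) := by
  rintro ⟨x, u⟩ ⟨y, v⟩ h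
  simpa [letters] using h

theorem code_injective : Function.Injective code :=
  (List.map_injective_iff.2 Letter.toBool_injective).comp letters_injective

theorem code_mul (u v : Word) : code (u * v) = code u ++ code v := by
  rw [code, letters_mul, List.map_append]; rfl

theorem code_ne_nil (u : Word) : code u ≠ [] := by
  simp [code, letters]

theorem isSegment_iff_occ (u : Word) : IsSegment thueMorse u ↔ Occ (code u) := by
  refine exists_congr fun m => ?_
  rw [occAt_iff_eq, code, List.length_map, letters_length,
    ← (List.map_injective_iff.2 Letter.toBool_injective).eq_iff, List.map_map]
  rfl

theorem code_map (φ : Word →ₙ* Word) (w : Word) :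
    code (φ w) = (code w).flatMap fun x => code (φ (FreeSemigroup.of (if x then b else a))) := by
  induction w using FreeSemigroup.recOnMul with
  | ih1 x => cases x <;> simp [code, letters, Letter.toBool]
  | ih2 x y hx hy => rw [map_mul, code_mul, hx, hy, code_mul, List.flatMap_append]

theorem isUnavoidableIn_iff {A B : Type*} {w : FreeSemigroup A} {x : ℕ → B} :
    IsUnavoidableIn w x ↔ ∃ φ : FreeSemigroup A →ₙ* FreeSemigroup B, IsSegment x (φ w) :=
  not_not

theorem IsUnavoidableIn.pattern_code {w : Word} (h : IsUnavoidableIn w thueMorse) :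
    Pattern (code w) := by
  obtain ⟨φ, hφ⟩ := isUnavoidableIn_iff.1 h
  rw [isSegment_iff_occ, code_map] at hφ
  exact ⟨_, fun _ => code_ne_nil _, hφ⟩

theorem isUnavoidableIn_of_lift {w : Word} (f : Letter → Word)
    (h : code (FreeSemigroup.lift f w) <:+: initialSegment) : IsUnavoidableIn w thueMorse :=
  isUnavoidableIn_iff.2 ⟨FreeSemigroup.lift f,
    (isSegment_iff_occ _).2 (occ_of_infix_initialSegment h)⟩

end ThueMorse
open ThueMorse in
theorem mainTheorem1 :
    (∀ w : Word, IsUnavoidableIn w thueMorse ↔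
      (IsSegment thueMorse w ∨ w = wa * wa * wb * wa * wa ∨ w = wb * wb * wa * wb * wb)) ∧
    ¬ IsSegment thueMorse (wa * wa * wb * wa * wa) ∧
    ¬ IsSegment thueMorse (wb * wb * wa * wb * wb) := by
  refine ⟨fun w => ⟨fun h => ?_, ?_⟩, ?_, ?_⟩
  · refine h.pattern_code.occ_or_mem_exceptions.imp (isSegment_iff_occ w).2 fun he => ?_
    simp only [exceptions, List.mem_cons, List.not_mem_nil, or_false] at he
    exact he.imp (fun h => code_injective h) (fun h => code_injective h)
  · rintro (h | rfl | rfl)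
    · exact isUnavoidableIn_iff.2 ⟨MulHom.id _, h⟩
    · exact isUnavoidableIn_of_lift (fun x => match x with | .a => wa | .b => wb * wb)
        (by decide +kernel)
    · exact isUnavoidableIn_of_lift (fun x => match x with | .a => wa * wa | .b => wb)
        (by decide +kernel)
  · rw [isSegment_iff_occ]
    exact fun h => absurd (h.desubstitutable 3) (by decide +kernel)
  · rw [isSegment_iff_occ]
    exact fun h => absurd (h.desubstitutable 3) (by decide +kernel)
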